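/- Let $p>1$ be an odd integer, let $q\in\mathbb C$ be a primitive $p$-th root of unity, fix $h\in\mathbb C$ with $e^{h}=q$, and put $q^{z}=e^{hz}$ and $[z]_q=\frac{q^{z}-q^{-z}}{q-q^{-1}}$ for $z\in\mathbb C$. Let $U_q(sl_2)$ be the associative $\mathbb C$-algebra with generators $e,f,K,K^{-1}$ and relations $KK^{-1}=K^{-1}K=1$, $KeK^{-1}=q^2e$, $KfK^{-1}=q^{-2}f$, $[e,f]=\frac{K-K^{-1}}{q-q^{-1}}$. Let $U_q(\widehat{sl_2})$ be the associative $\mathbb C$-algebra with generators $e_i,f_i,K_i,K_i^{-1}$ ($i=0,1$) and relations $K_iK_i^{-1}=K_i^{-1}K_i=1$, $K_0K_1=K_1K_0$, $K_ie_iK_i^{-1}=q^2e_i$, $K_if_iK_i^{-1}=q^{-2}f_i$, $[e_i,f_i]=\frac{K_i-K_i^{-1}}{q-q^{-1}}$ and, for $i\neq j$, $K_ie_jK_i^{-1}=q^{-2}e_j$, $K_if_jK_i^{-1}=q^{2}f_j$, $[e_i,f_j]=0$, $e_i^3e_j-[3]_qe_i^2e_je_i+[3]_qe_ie_je_i^2-e_je_i^3=0$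 and the same identity with $f$ in place of $e$. Its comultiplication is $\Delta(e_i)=e_i\otimes K_i+1\otimes e_i$, $\Delta(f_i)=f_i\otimes 1+K_i^{-1}\otimes f_i$, $\Delta(K_i^{\pm1})=K_i^{\pm1}\otimes K_i^{\pm1}$. For $x\in\mathbb C\setminus\{0\}$ the evaluation homomorphism $ev_x:U_q(\widehat{sl_2})\to U_q(sl_2)$ is given by $e_0\mapsto q^{-1}xf$, $e_1\mapsto e$, $f_0\mapsto qx^{-1}e$, $f_1\mapsto f$, $K_0\mapsto K^{-1}$, $K_1\mapsto K$. For $\lambda\in\mathbb C$ let $V_\lambda$ be the $p$-dimensional $U_q(sl_2)$-module with basis $v_0,\dots,v_{p-1}$ and $K^{\pm1}v_i=q^{\pm(\lambda-2i)}v_i$, $fv_i=[i+1]_qv_{i+1}$ ($i\neq p-1$), $fv_{p-1}=0$, $ev_i=[\lambda+1-i]_qv_{i-1}$ ($i\ne 0$), $ev_0=0$. Let $\lambda_1,\lambda_2\in\mathbb C$ and $x,y\in\mathbb C\setminus\{0\}$, and let $g\in U_q(\widehat{sl_2})$ act on $V_{\lambda_1}(x)\otimes V_{\lambda_2}(y)=V_{\lambda_1}\otimes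 V_{\lambda_2}$ through $(ev_x\otimes ev_y)\Delta(g)$; the action of $f$ on the tensor product is that of $f_1$. Let $v_0,w_0$ be the first basis vectors of $V_{\lambda_1},V_{\lambda_2}$ and $\Omega_0=\frac{[\lambda_2]_q}{[\lambda_1+1]_q}\,v_0\otimes w_0$. Assume (Condition 1) that $[\lambda_j+1-i]_q\neq0$ for $0\le i\le p$, $j=1,2$, and $[\lambda_1+\lambda_2-2j+1-i]_q\neq 0$ for $0\le i\le p$, $0\le j\le p-1$. Theorem 5.1. The $p^2$ vectors $e_0^{\,i}f^{\,j}\Omega_0$ ($i,j=0,1,\dots,p-1$) form a basis of $V_{\lambda_1}\otimes V_{\lambda_2}$ if and only if (Condition 3) $$\frac{y}{x}\neq q^{-(\lambda_1+\lambda_2-2(l-1))}\qquad\text{for all } l=1,2,\dots,p-1 .$$ -/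

import Mathlib

namespace QuantumAffine

open scoped TensorProduct

/-! ### The quantum algebra of `sl₂` -/

/-- Names of the generators `e, f, K, K⁻¹`. -/
inductive Sl2Gen
  | e | f | K | Kinv

section Sl2Relations

open Sl2Gen

/-- The free generators of the algebra `U_q(sl₂)`. -/
noncomputable abbrev sg (g : Sl2Gen) : FreeAlgebra ℂ Sl2Gen := FreeAlgebra.ι ℂ g

/-- The defining relations of `U_q(sl₂)`. -/
inductive Sl2Rel (q : ℂˣ) : FreeAlgebra ℂ Sl2Gen → FreeAlgebra ℂ Sl2Gen → Prop
  | K_Kinv : Sl2Rel q (sg K * sg Kinv) 1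
  | Kinv_K : Sl2Rel q (sg Kinv * sg K) 1
  | K_e : Sl2Rel q (sg K * sg e * sg Kinv) ((q : ℂ) ^ 2 • sg e)
  | K_f : Sl2Rel q (sg K * sg f * sg Kinv) ((q : ℂ)⁻¹ ^ 2 • sg f)
  | e_f : Sl2Rel q (sg e * sg f - sg f * sg e)
      (((q : ℂ) - (q : ℂ)⁻¹)⁻¹ • (sg K - sg Kinv))

end Sl2Relations

/-- The quantum algebra `U_q(sl₂)`: generators `e, f, K, K⁻¹` and the relations above. -/
def Uqsl2 (q : ℂˣ) : Type := RingQuot (Sl2Rel q)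

noncomputable instance (q : ℂˣ) : Ring (Uqsl2 q) := inferInstanceAs (Ring (RingQuot (Sl2Rel q)))

noncomputable instance (q : ℂˣ) : Algebra ℂ (Uqsl2 q) :=
  inferInstanceAs (Algebra ℂ (RingQuot (Sl2Rel q)))

/-- The quotient map from the free algebra onto `U_q(sl₂)`. -/
noncomputable def Uqsl2.mk (q : ℂˣ) : FreeAlgebra ℂ Sl2Gen →ₐ[ℂ] Uqsl2 q :=
  RingQuot.mkAlgHom ℂ (Sl2Rel q)

/-- The generators of `U_q(sl₂)` as elements of that algebra. -/
noncomputable def Uqsl2.gen (q : ℂˣ) (g : Sl2Gen) : Uqsl2 q := Uqsl2.mk q (sg g)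

theorem Uqsl2.mk_rel {q : ℂˣ} {a b : FreeAlgebra ℂ Sl2Gen} (h : Sl2Rel q a b) :
    Uqsl2.mk q a = Uqsl2.mk q b := RingQuot.mkAlgHom_rel ℂ h

/-- Elements `e, f, K, K'` of an algebra satisfy the relations of `U_q(sl₂)`. -/
structure IsSl2 {A : Type*} [Ring A] [Algebra ℂ A] (q : ℂˣ) (e f K K' : A) : Prop where
  K_K' : K * K' = 1
  K'_K : K' * K = 1
  K_e : K * e * K' = (q : ℂ) ^ 2 • e
  K_f : K * f * K' = (q : ℂ)⁻¹ ^ 2 • f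
  e_f : e * f - f * e = ((q : ℂ) - (q : ℂ)⁻¹)⁻¹ • (K - K')

theorem Uqsl2.isSl2 (q : ℂˣ) :
    IsSl2 q (Uqsl2.gen q .e) (Uqsl2.gen q .f) (Uqsl2.gen q .K) (Uqsl2.gen q .Kinv) where
  K_K' := by simpa only [Uqsl2.gen, map_mul, map_one] using Uqsl2.mk_rel (Sl2Rel.K_Kinv (q := q))
  K'_K := by simpa only [Uqsl2.gen, map_mul, map_one] using Uqsl2.mk_rel (Sl2Rel.Kinv_K (q := q))
  K_e := by simpa only [Uqsl2.gen, map_mul, map_smul] using Uqsl2.mk_rel (Sl2Rel.K_e (q := q))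
  K_f := by simpa only [Uqsl2.gen, map_mul, map_smul] using Uqsl2.mk_rel (Sl2Rel.K_f (q := q))
  e_f := by
    simpa only [Uqsl2.gen, map_mul, map_smul, map_sub] using Uqsl2.mk_rel (Sl2Rel.e_f (q := q))

/-- The assignment of elements to the names of the generators of `U_q(sl₂)`. -/
def sl2Assign {A : Type*} (e f K K' : A) : Sl2Gen → A
  | .e => e
  | .f => f
  | .K => K
  | .Kinv => K'

/-- The algebra homomorphism out of `U_q(sl₂)` with prescribed values on the generators. -/
noncomputable def Uqsl2.lift {A : Type*} [Ring A] [Algebra ℂ A] {q : ℂˣ} {e f K K' : A}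
    (H : IsSl2 q e f K K') : Uqsl2 q →ₐ[ℂ] A :=
  RingQuot.liftAlgHom ℂ ⟨FreeAlgebra.lift ℂ (sl2Assign e f K K'), by
    intro a b hab
    cases hab
    · simpa [sl2Assign] using H.K_K'
    · simpa [sl2Assign] using H.K'_K
    · simpa [sl2Assign] using H.K_e
    · simpa [sl2Assign] using H.K_f
    · simpa [sl2Assign] using H.e_f⟩

theorem Uqsl2.lift_gen {A : Type*} [Ring A] [Algebra ℂ A] {q : ℂˣ} {e f K K' : A}
    (H : IsSl2 q e f K K') (g : Sl2Gen) :
    Uqsl2.lift H (Uqsl2.gen q g) = sl2Assign e f K K' g := by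
  refine (RingQuot.liftAlgHom_mkAlgHom_apply ℂ _ _ _).trans ?_
  simp

/-! ### The quantum affine algebra -/

/-- Names of the generators `e_i, f_i, K_i, K_i⁻¹`, `i = 0, 1`. -/
inductive AffGen
  | e (i : Fin 2) | f (i : Fin 2) | K (i : Fin 2) | Kinv (i : Fin 2)

section AffRelations

open AffGen

/-- The free generators of the quantum affine algebra. -/
noncomputable abbrev ag (g : AffGen) : FreeAlgebra ℂ AffGen := FreeAlgebra.ι ℂ g

/-- The `q`-number `[3]_q = (q³ - q⁻³) / (q - q⁻¹) = q² + 1 + q⁻²`. -/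
noncomputable def qthree (q : ℂˣ) : ℂ := (q : ℂ) ^ 2 + 1 + (q : ℂ)⁻¹ ^ 2

/-- The `q`-Serre expression `a³b - [3] a²ba + [3] aba² - ba³`. -/
noncomputable def serre {A : Type*} [Ring A] [Algebra ℂ A] (q : ℂˣ) (a b : A) : A :=
  a * a * a * b - qthree q • (a * a * b * a) + qthree q • (a * b * a * a) - b * a * a * a

/-- The defining relations of the quantum affine algebra of `sl₂`. -/
inductive AffRel (q : ℂˣ) : FreeAlgebra ℂ AffGen → FreeAlgebra ℂ AffGen → Prop
  | K_Kinv (i : Fin 2) : AffRel q (ag (K i) * ag (Kinv i)) 1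
  | Kinv_K (i : Fin 2) : AffRel q (ag (Kinv i) * ag (K i)) 1
  | K_K : AffRel q (ag (K 0) * ag (K 1)) (ag (K 1) * ag (K 0))
  | K_e_same (i : Fin 2) : AffRel q (ag (K i) * ag (e i) * ag (Kinv i)) ((q : ℂ) ^ 2 • ag (e i))
  | K_f_same (i : Fin 2) :
      AffRel q (ag (K i) * ag (f i) * ag (Kinv i)) ((q : ℂ)⁻¹ ^ 2 • ag (f i))
  | K_e_ne (i j : Fin 2) (hij : i ≠ j) :
      AffRel q (ag (K i) * ag (e j) * ag (Kinv i)) ((q : ℂ)⁻¹ ^ 2 • ag (e j))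
  | K_f_ne (i j : Fin 2) (hij : i ≠ j) :
      AffRel q (ag (K i) * ag (f j) * ag (Kinv i)) ((q : ℂ) ^ 2 • ag (f j))
  | e_f_same (i : Fin 2) : AffRel q (ag (e i) * ag (f i) - ag (f i) * ag (e i))
      (((q : ℂ) - (q : ℂ)⁻¹)⁻¹ • (ag (K i) - ag (Kinv i)))
  | e_f_ne (i j : Fin 2) (hij : i ≠ j) : AffRel q (ag (e i) * ag (f j) - ag (f j) * ag (e i)) 0
  | serre_e (i j : Fin 2) (hij : i ≠ j) : AffRel q (serre q (ag (e i)) (ag (e j))) 0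
  | serre_f (i j : Fin 2) (hij : i ≠ j) : AffRel q (serre q (ag (f i)) (ag (f j))) 0

end AffRelations

/-- The quantum affine algebra `U_q(ŝl₂)`: generators `e_i, f_i, K_i, K_i⁻¹` and the relations
above. -/
def UqAff (q : ℂˣ) : Type := RingQuot (AffRel q)

noncomputable instance (q : ℂˣ) : Ring (UqAff q) := inferInstanceAs (Ring (RingQuot (AffRel q)))

noncomputable instance (q : ℂˣ) : Algebra ℂ (UqAff q) :=
  inferInstanceAs (Algebra ℂ (RingQuot (AffRel q)))

/-- The quotient map from the free algebra onto `U_q(ŝl₂)`. -/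
noncomputable def UqAff.mk (q : ℂˣ) : FreeAlgebra ℂ AffGen →ₐ[ℂ] UqAff q :=
  RingQuot.mkAlgHom ℂ (AffRel q)

/-- The generators of `U_q(ŝl₂)` as elements of that algebra. -/
noncomputable def UqAff.gen (q : ℂˣ) (g : AffGen) : UqAff q := UqAff.mk q (ag g)

theorem UqAff.mk_rel {q : ℂˣ} {a b : FreeAlgebra ℂ AffGen} (h : AffRel q a b) :
    UqAff.mk q a = UqAff.mk q b := RingQuot.mkAlgHom_rel ℂ h

/-- Elements `e i, f i, K i, K' i` of an algebra satisfy the relations of `U_q(ŝl₂)`. -/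
structure IsAff {A : Type*} [Ring A] [Algebra ℂ A] (q : ℂˣ) (e f K K' : Fin 2 → A) : Prop where
  K_K' : ∀ i, K i * K' i = 1
  K'_K : ∀ i, K' i * K i = 1
  K_K : K 0 * K 1 = K 1 * K 0
  K_e_same : ∀ i, K i * e i * K' i = (q : ℂ) ^ 2 • e i
  K_f_same : ∀ i, K i * f i * K' i = (q : ℂ)⁻¹ ^ 2 • f i
  K_e_ne : ∀ i j, i ≠ j → K i * e j * K' i = (q : ℂ)⁻¹ ^ 2 • e j
  K_f_ne : ∀ i j, i ≠ j → K i * f j * K' i = (q : ℂ) ^ 2 • f j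
  e_f_same : ∀ i, e i * f i - f i * e i = ((q : ℂ) - (q : ℂ)⁻¹)⁻¹ • (K i - K' i)
  e_f_ne : ∀ i j, i ≠ j → e i * f j - f j * e i = 0
  serre_e : ∀ i j, i ≠ j → serre q (e i) (e j) = 0
  serre_f : ∀ i j, i ≠ j → serre q (f i) (f j) = 0

theorem map_serre {A B : Type*} [Ring A] [Algebra ℂ A] [Ring B] [Algebra ℂ B] (φ : A →ₐ[ℂ] B)
    (q : ℂˣ) (a b : A) : φ (serre q a b) = serre q (φ a) (φ b) := by
  simp only [serre, map_mul, map_smul, map_sub, map_add]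

theorem UqAff.isAff (q : ℂˣ) :
    IsAff q (fun i => UqAff.gen q (.e i)) (fun i => UqAff.gen q (.f i))
      (fun i => UqAff.gen q (.K i)) (fun i => UqAff.gen q (.Kinv i)) where
  K_K' i := by simpa only [UqAff.gen, map_mul, map_one] using UqAff.mk_rel (AffRel.K_Kinv (q := q) i)
  K'_K i := by simpa only [UqAff.gen, map_mul, map_one] using UqAff.mk_rel (AffRel.Kinv_K (q := q) i)
  K_K := by simpa only [UqAff.gen, map_mul] using UqAff.mk_rel (AffRel.K_K (q := q))
  K_e_same i := by
    simpa only [UqAff.gen, map_mul, map_smul] using UqAff.mk_rel (AffRel.K_e_same (q := q) i)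
  K_f_same i := by
    simpa only [UqAff.gen, map_mul, map_smul] using UqAff.mk_rel (AffRel.K_f_same (q := q) i)
  K_e_ne i j h := by
    simpa only [UqAff.gen, map_mul, map_smul] using UqAff.mk_rel (AffRel.K_e_ne (q := q) i j h)
  K_f_ne i j h := by
    simpa only [UqAff.gen, map_mul, map_smul] using UqAff.mk_rel (AffRel.K_f_ne (q := q) i j h)
  e_f_same i := by
    simpa only [UqAff.gen, map_mul, map_smul, map_sub] using
      UqAff.mk_rel (AffRel.e_f_same (q := q) i)
  e_f_ne i j h := by
    simpa only [UqAff.gen, map_mul, map_sub, map_zero] using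
      UqAff.mk_rel (AffRel.e_f_ne (q := q) i j h)
  serre_e i j h := by
    simpa only [UqAff.gen, map_serre, map_zero] using UqAff.mk_rel (AffRel.serre_e (q := q) i j h)
  serre_f i j h := by
    simpa only [UqAff.gen, map_serre, map_zero] using UqAff.mk_rel (AffRel.serre_f (q := q) i j h)

/-- The assignment of elements to the names of the generators of `U_q(ŝl₂)`. -/
def affAssign {A : Type*} (e f K K' : Fin 2 → A) : AffGen → A
  | .e i => e i
  | .f i => f i
  | .K i => K i
  | .Kinv i => K' i

/-- The algebra homomorphism out of `U_q(ŝl₂)` with prescribed values on the generators. -/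
noncomputable def UqAff.lift {A : Type*} [Ring A] [Algebra ℂ A] {q : ℂˣ} {e f K K' : Fin 2 → A}
    (H : IsAff q e f K K') : UqAff q →ₐ[ℂ] A :=
  RingQuot.liftAlgHom ℂ ⟨FreeAlgebra.lift ℂ (affAssign e f K K'), by
    intro a b hab
    cases hab with
    | K_Kinv i => simpa [affAssign] using H.K_K' i
    | Kinv_K i => simpa [affAssign] using H.K'_K i
    | K_K => simpa [affAssign] using H.K_K
    | K_e_same i => simpa [affAssign] using H.K_e_same i
    | K_f_same i => simpa [affAssign] using H.K_f_same i
    | K_e_ne i j h => simpa [affAssign] using H.K_e_ne i j h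
    | K_f_ne i j h => simpa [affAssign] using H.K_f_ne i j h
    | e_f_same i => simpa [affAssign] using H.e_f_same i
    | e_f_ne i j h => simpa [affAssign] using H.e_f_ne i j h
    | serre_e i j h => simpa [affAssign, map_serre] using H.serre_e i j h
    | serre_f i j h => simpa [affAssign, map_serre] using H.serre_f i j h⟩

theorem UqAff.lift_gen {A : Type*} [Ring A] [Algebra ℂ A] {q : ℂˣ} {e f K K' : Fin 2 → A}
    (H : IsAff q e f K K') (g : AffGen) :
    UqAff.lift H (UqAff.gen q g) = affAssign e f K K' g := by
  refine (RingQuot.liftAlgHom_mkAlgHom_apply ℂ _ _ _).trans ?_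
  simp

/-! ### The evaluation homomorphism -/

theorem serre_of_sl2 {A : Type*} [Ring A] [Algebra ℂ A] {q : ℂˣ} {a b k k' : A} {s : ℂ}
    (hab : a * b = b * a + s • (k - k'))
    (hka : k * a = (q : ℂ) ^ 2 • (a * k)) (hka' : k' * a = (q : ℂ)⁻¹ ^ 2 • (a * k')) :
    serre q a b = 0 := by
  have hq : (q : ℂ) ≠ 0 := q.ne_zero
  have r1 : ∀ z, a * (b * z) = b * (a * z) + s • (k * z - k' * z) := fun z => by
    rw [← mul_assoc, hab]; simp [add_mul, sub_mul, mul_assoc]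
  have r2 : ∀ z, k * (a * z) = (q : ℂ) ^ 2 • (a * (k * z)) := fun z => by
    rw [← mul_assoc, hka]; simp [mul_assoc]
  have r3 : ∀ z, k' * (a * z) = (q : ℂ)⁻¹ ^ 2 • (a * (k' * z)) := fun z => by
    rw [← mul_assoc, hka']; simp [mul_assoc]
  simp only [serre, qthree, mul_assoc, hab, hka, hka', r1, r2, r3, mul_add, mul_sub, mul_smul_comm,
    add_mul, sub_mul, smul_mul_assoc]
  match_scalars <;> field_simp <;> ring

theorem comm_of_conj {A : Type*} [Ring A] [Algebra ℂ A] {k k' a : A} {c : ℂ}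
    (h : k' * k = 1) (H : k * a * k' = c • a) : k * a = c • (a * k) := by
  rw [← smul_mul_assoc, ← H, mul_assoc _ k', h, mul_one]

theorem conj_of_comm {A : Type*} [Ring A] [Algebra ℂ A] {k k' a : A} {c : ℂ}
    (h : k * k' = 1) (H : k * a = c • (a * k)) : k * a * k' = c • a := by
  rw [H, smul_mul_assoc, mul_assoc, h, mul_one]

theorem comm_inv {A : Type*} [Ring A] [Algebra ℂ A] {k k' a : A} {c d : ℂ} (hcd : d * c = 1)
    (h : k * k' = 1) (h' : k' * k = 1) (H : k * a = c • (a * k)) : k' * a = d • (a * k') := by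
  have h1 : k' * (k * a) * k' = c • (k' * (a * k) * k') := by rw [H]; simp
  have h2 : k' * (k * a) * k' = a * k' := by rw [← mul_assoc k', h', one_mul]
  have h3 : k' * (a * k) * k' = k' * a := by simp only [mul_assoc, h, mul_one]
  rw [h2, h3] at h1
  rw [h1, smul_smul, hcd, one_smul]

theorem qsq_mul (q : ℂˣ) : (q : ℂ) ^ 2 * (q : ℂ)⁻¹ ^ 2 = 1 := by
  have hq : (q : ℂ) ≠ 0 := q.ne_zero
  field_simp

theorem qsq_mul' (q : ℂˣ) : (q : ℂ)⁻¹ ^ 2 * (q : ℂ) ^ 2 = 1 := by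
  rw [mul_comm, qsq_mul]

theorem serre_smul {A : Type*} [Ring A] [Algebra ℂ A] {q : ℂˣ} {a b : A} (s t : ℂ)
    (h : serre q a b = 0) : serre q (s • a) (t • b) = 0 := by
  have : serre q (s • a) (t • b) = (s ^ 3 * t) • serre q a b := by
    simp only [serre, smul_mul_assoc, mul_smul_comm, smul_smul, smul_sub, smul_add]
    match_scalars <;> ring
  rw [this, h, smul_zero]

/-- The images `ev_x(e₀) = q⁻¹ x f`, `ev_x(e₁) = e`, `ev_x(f₀) = q x⁻¹ e`, `ev_x(f₁) = f`,
`ev_x(K₀) = K⁻¹`, `ev_x(K₁) = K` satisfy the relations of `U_q(ŝl₂)`. -/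
theorem IsSl2.isAff_ev {A : Type*} [Ring A] [Algebra ℂ A] {q : ℂˣ} {e f K K' : A}
    (H : IsSl2 q e f K K') (x : ℂˣ) :
    IsAff q ![((q : ℂ)⁻¹ * x) • f, e] ![((q : ℂ) * (x : ℂ)⁻¹) • e, f] ![K', K] ![K, K'] := by
  have hq : (q : ℂ) ≠ 0 := q.ne_zero
  have hx : (x : ℂ) ≠ 0 := x.ne_zero
  have e1 := comm_of_conj H.K'_K H.K_e
  have f1 := comm_of_conj H.K'_K H.K_f
  have e2 := comm_inv (qsq_mul' q) H.K_K' H.K'_K e1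
  have f2 := comm_inv (qsq_mul q) H.K_K' H.K'_K f1
  have e3 := conj_of_comm H.K'_K e2
  have f3 := conj_of_comm H.K'_K f2
  have hef : e * f = f * e + ((q : ℂ) - (q : ℂ)⁻¹)⁻¹ • (K - K') := by
    rw [← H.e_f]; abel
  have hfe : f * e = e * f + ((q : ℂ) - (q : ℂ)⁻¹)⁻¹ • (K' - K) := by
    rw [hef, add_assoc, ← smul_add]; simp
  have s1 : serre q e f = 0 := serre_of_sl2 hef e1 e2
  have s2 : serre q f e = 0 := serre_of_sl2 hfe f2 f1
  refine ⟨?_, ?_, ?_, ?_, ?_, ?_, ?_, ?_, ?_, ?_, ?_⟩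
  · intro i; fin_cases i <;> simp [H.K_K', H.K'_K]
  · intro i; fin_cases i <;> simp [H.K_K', H.K'_K]
  · simp [H.K_K', H.K'_K]
  · intro i; fin_cases i
    · simp only [Fin.zero_eta, Matrix.cons_val_zero, mul_smul_comm, smul_mul_assoc, f3]
      rw [smul_comm]
    · simpa using H.K_e
  · intro i; fin_cases i
    · simp only [Fin.zero_eta, Matrix.cons_val_zero, mul_smul_comm, smul_mul_assoc, e3]
      rw [smul_comm]
    · simpa using H.K_f
  · intro i j hij; fin_cases i <;> fin_cases j
    · exact absurd rfl hij
    · simpa using e3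
    · simp only [Fin.zero_eta, Fin.mk_one, Matrix.cons_val_zero, Matrix.cons_val_one,
        mul_smul_comm, smul_mul_assoc, H.K_f]
      rw [smul_comm]
    · exact absurd rfl hij
  · intro i j hij; fin_cases i <;> fin_cases j
    · exact absurd rfl hij
    · simpa using f3
    · simp only [Fin.zero_eta, Fin.mk_one, Matrix.cons_val_zero, Matrix.cons_val_one,
        mul_smul_comm, smul_mul_assoc, H.K_e]
      rw [smul_comm]
    · exact absurd rfl hij
  · intro i; fin_cases i
    · simp only [Fin.zero_eta, Matrix.cons_val_zero, mul_smul_comm, smul_mul_assoc, hfe,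
        smul_smul]
      have : (q : ℂ) * (x : ℂ)⁻¹ * ((q : ℂ)⁻¹ * x) = 1 := by field_simp
      rw [mul_comm ((q : ℂ)⁻¹ * x), this, one_smul, one_smul]
      abel
    · simpa using H.e_f
  · intro i j hij; fin_cases i <;> fin_cases j
    · exact absurd rfl hij
    · simp
    · simp
    · exact absurd rfl hij
  · intro i j hij; fin_cases i <;> fin_cases j
    · exact absurd rfl hij
    · simpa using serre_smul ((q : ℂ)⁻¹ * x) 1 s2
    · simpa using serre_smul 1 ((q : ℂ)⁻¹ * x) s1
    · exact absurd rfl hij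
  · intro i j hij; fin_cases i <;> fin_cases j
    · exact absurd rfl hij
    · simpa using serre_smul ((q : ℂ) * (x : ℂ)⁻¹) 1 s1
    · simpa using serre_smul 1 ((q : ℂ) * (x : ℂ)⁻¹) s2
    · exact absurd rfl hij

/-- The evaluation homomorphism `ev_x : U_q(ŝl₂) → U_q(sl₂)`. -/
noncomputable def ev (q x : ℂˣ) : UqAff q →ₐ[ℂ] Uqsl2 q :=
  UqAff.lift ((Uqsl2.isSl2 q).isAff_ev x)

/-! ### The comultiplication -/

theorem serre_add {B : Type*} [Ring B] [Algebra ℂ B] {q : ℂˣ} {a b c d : B}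
    (hab : a * b = (q : ℂ) ^ 2 • (b * a))
    (had : a * d = (q : ℂ)⁻¹ ^ 2 • (d * a)) (hcb : c * b = (q : ℂ)⁻¹ ^ 2 • (b * c))
    (hac : serre q a c = 0) (hbd : serre q b d = 0) : serre q (a + b) (c + d) = 0 := by
  have hq : (q : ℂ) ≠ 0 := q.ne_zero
  have r1 : ∀ z, a * (b * z) = (q : ℂ) ^ 2 • (b * (a * z)) := fun z => by
    rw [← mul_assoc, hab]; simp [mul_assoc]
  have r3 : ∀ z, a * (d * z) = (q : ℂ)⁻¹ ^ 2 • (d * (a * z)) := fun z => by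
    rw [← mul_assoc, had]; simp [mul_assoc]
  have r4 : ∀ z, c * (b * z) = (q : ℂ)⁻¹ ^ 2 • (b * (c * z)) := fun z => by
    rw [← mul_assoc, hcb]; simp [mul_assoc]
  have key : serre q (a + b) (c + d) = serre q a c + serre q b d := by
    simp only [serre, qthree, mul_assoc, mul_add, add_mul, smul_mul_assoc, mul_smul_comm,
      hab, had, hcb, r1, r3, r4]
    match_scalars <;> field_simp <;> ring
  rw [key, hac, hbd, add_zero]

theorem serre_tmul_left {A B : Type*} [Ring A] [Algebra ℂ A] [Ring B] [Algebra ℂ B] {q : ℂˣ}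
    {a b : A} {k l : B} (hkl : k * l = l * k) (h : serre q a b = 0) :
    serre q (a ⊗ₜ[ℂ] k) (b ⊗ₜ[ℂ] l) = 0 := by
  have hkl' : ∀ z, k * (l * z) = l * (k * z) := fun z => by
    rw [← mul_assoc, hkl, mul_assoc]
  have : serre q (a ⊗ₜ[ℂ] k) (b ⊗ₜ[ℂ] l) = serre q a b ⊗ₜ[ℂ] (k * k * k * l) := by
    simp only [serre, Algebra.TensorProduct.tmul_mul_tmul, TensorProduct.add_tmul,
      TensorProduct.sub_tmul, ← TensorProduct.smul_tmul', mul_assoc, hkl, hkl']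
  rw [this, h, TensorProduct.zero_tmul]

theorem serre_tmul_right {A B : Type*} [Ring A] [Algebra ℂ A] [Ring B] [Algebra ℂ B] {q : ℂˣ}
    {a b : A} {k l : B} (hkl : k * l = l * k) (h : serre q a b = 0) :
    serre q (k ⊗ₜ[ℂ] a) (l ⊗ₜ[ℂ] b) = 0 := by
  have hkl' : ∀ z, k * (l * z) = l * (k * z) := fun z => by
    rw [← mul_assoc, hkl, mul_assoc]
  have : serre q (k ⊗ₜ[ℂ] a) (l ⊗ₜ[ℂ] b) = (k * k * k * l) ⊗ₜ[ℂ] serre q a b := by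
    simp only [serre, Algebra.TensorProduct.tmul_mul_tmul, TensorProduct.tmul_add,
      TensorProduct.tmul_sub, TensorProduct.tmul_smul, mul_assoc, hkl, hkl']
  rw [this, h, TensorProduct.tmul_zero]

/-- The elements `e_i ⊗ K_i + 1 ⊗ e_i`, `f_i ⊗ 1 + K_i⁻¹ ⊗ f_i`, `K_i ⊗ K_i`, `K_i⁻¹ ⊗ K_i⁻¹`
satisfy the relations of `U_q(ŝl₂)`. -/
theorem IsAff.isAff_comul {A : Type*} [Ring A] [Algebra ℂ A] {q : ℂˣ} {e f K K' : Fin 2 → A}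
    (H : IsAff q e f K K') :
    IsAff q (fun i => e i ⊗ₜ[ℂ] K i + 1 ⊗ₜ[ℂ] e i) (fun i => f i ⊗ₜ[ℂ] 1 + K' i ⊗ₜ[ℂ] f i)
      (fun i => K i ⊗ₜ[ℂ] K i) (fun i => K' i ⊗ₜ[ℂ] K' i) := by
  have hq : (q : ℂ) ≠ 0 := q.ne_zero
  have KK : ∀ i j, K i * K j = K j * K i := by
    intro i j; fin_cases i <;> fin_cases j <;> simp [H.K_K]
  have KK' : ∀ i j, K' i * K' j = K' j * K' i := by
    intro i j
    have h : (K j * K i) * (K' i * K' j) = 1 := by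
      rw [mul_assoc, ← mul_assoc (K i), H.K_K', one_mul, H.K_K']
    have h' : (K' j * K' i) * (K j * K i) = 1 := by
      rw [KK, mul_assoc, ← mul_assoc (K' i), H.K'_K, one_mul, H.K'_K]
    exact (left_inv_eq_right_inv h' h).symm
  have eS := fun i => comm_of_conj (H.K'_K i) (H.K_e_same i)
  have fS := fun i => comm_of_conj (H.K'_K i) (H.K_f_same i)
  have eN := fun i j hij => comm_of_conj (H.K'_K i) (H.K_e_ne i j hij)
  have fN := fun i j hij => comm_of_conj (H.K'_K i) (H.K_f_ne i j hij)
  have eS' := fun i => comm_inv (qsq_mul' q) (H.K_K' i) (H.K'_K i) (eS i)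
  have fS' := fun i => comm_inv (qsq_mul q) (H.K_K' i) (H.K'_K i) (fS i)
  have eN' := fun i j hij => comm_inv (qsq_mul q) (H.K_K' i) (H.K'_K i) (eN i j hij)
  have fN' := fun i j hij => comm_inv (qsq_mul' q) (H.K_K' i) (H.K'_K i) (fN i j hij)
  have KKi : ∀ i j, K i * K j * K' i = K j := fun i j => by
    rw [KK, mul_assoc, H.K_K', mul_one]
  have KK'i : ∀ i j, K i * K' j * K' i = K' j := fun i j => by
    rw [mul_assoc, KK', ← mul_assoc, H.K_K', one_mul]
  refine ⟨?_, ?_, ?_, ?_, ?_, ?_, ?_, ?_, ?_, ?_, ?_⟩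
  · intro i; simp [H.K_K', Algebra.TensorProduct.one_def]
  · intro i; simp [H.K'_K, Algebra.TensorProduct.one_def]
  · simp [H.K_K]
  · intro i
    simp only [mul_add, add_mul, Algebra.TensorProduct.tmul_mul_tmul, H.K_e_same, KKi, mul_one,
      H.K_K', TensorProduct.tmul_smul, smul_add, TensorProduct.smul_tmul']
  · intro i
    simp only [mul_add, add_mul, Algebra.TensorProduct.tmul_mul_tmul, H.K_f_same, mul_one, one_mul,
      H.K_K', TensorProduct.tmul_smul, smul_add, TensorProduct.smul_tmul']
  · intro i j hij
    simp only [mul_add, add_mul, Algebra.TensorProduct.tmul_mul_tmul, H.K_e_ne i j hij, KKi,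
      mul_one, H.K_K', TensorProduct.tmul_smul, smul_add, TensorProduct.smul_tmul']
  · intro i j hij
    simp only [mul_add, add_mul, Algebra.TensorProduct.tmul_mul_tmul, H.K_f_ne i j hij, KK'i,
      mul_one, H.K_K', TensorProduct.tmul_smul, smul_add, TensorProduct.smul_tmul']
  · intro i
    have hef : e i * f i = f i * e i + ((q : ℂ) - (q : ℂ)⁻¹)⁻¹ • (K i - K' i) := by
      rw [← H.e_f_same]; abel
    simp only [mul_add, add_mul, Algebra.TensorProduct.tmul_mul_tmul, mul_one, one_mul, eS', fS,
      hef, TensorProduct.tmul_smul, TensorProduct.add_tmul, TensorProduct.tmul_add,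
      TensorProduct.sub_tmul, TensorProduct.tmul_sub, ← TensorProduct.smul_tmul']
    match_scalars <;> field_simp <;> ring
  · intro i j hij
    have hef : e i * f j = f j * e i := sub_eq_zero.mp (H.e_f_ne i j hij)
    simp only [mul_add, add_mul, Algebra.TensorProduct.tmul_mul_tmul, mul_one, one_mul,
      eN' j i hij.symm, fN i j hij, hef, TensorProduct.tmul_smul, ← TensorProduct.smul_tmul']
    match_scalars <;> field_simp <;> ring
  · intro i j hij
    apply serre_add
    · simp only [Algebra.TensorProduct.tmul_mul_tmul, mul_one, one_mul, eS,
        TensorProduct.tmul_smul]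
    · simp only [Algebra.TensorProduct.tmul_mul_tmul, mul_one, one_mul, eN i j hij,
        TensorProduct.tmul_smul]
    · simp only [Algebra.TensorProduct.tmul_mul_tmul, mul_one, one_mul, eN j i hij.symm,
        TensorProduct.tmul_smul]
    · exact serre_tmul_left (KK i j) (H.serre_e i j hij)
    · exact serre_tmul_right rfl (H.serre_e i j hij)
  · intro i j hij
    rw [add_comm (f i ⊗ₜ[ℂ] (1 : A)), add_comm (f j ⊗ₜ[ℂ] (1 : A))]
    apply serre_add
    · simp only [Algebra.TensorProduct.tmul_mul_tmul, mul_one, one_mul, fS',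
        TensorProduct.smul_tmul']
    · simp only [Algebra.TensorProduct.tmul_mul_tmul, mul_one, one_mul, fN' i j hij,
        TensorProduct.smul_tmul']
    · simp only [Algebra.TensorProduct.tmul_mul_tmul, mul_one, one_mul, fN' j i hij.symm,
        TensorProduct.smul_tmul']
    · exact serre_tmul_right (KK' i j) (H.serre_f i j hij)
    · exact serre_tmul_left rfl (H.serre_f i j hij)

/-- The comultiplication `Δ` of `U_q(ŝl₂)`: `Δ e_i = e_i ⊗ K_i + 1 ⊗ e_i`,
`Δ f_i = f_i ⊗ 1 + K_i⁻¹ ⊗ f_i`, `Δ K_i = K_i ⊗ K_i`, `Δ K_i⁻¹ = K_i⁻¹ ⊗ K_i⁻¹`. -/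
noncomputable def comul (q : ℂˣ) : UqAff q →ₐ[ℂ] UqAff q ⊗[ℂ] UqAff q :=
  UqAff.lift (UqAff.isAff q).isAff_comul

/-! ### The modules `V_λ` -/

/-- `q ^ z` for `q = exp h` and a complex exponent `z`. -/
noncomputable def qpow (h z : ℂ) : ℂ := Complex.exp (h * z)

/-- The `q`-number `[z]_q = (q ^ z - q ^ (-z)) / (q - q⁻¹)` for `q = exp h`. -/
noncomputable def qnum (h z : ℂ) : ℂ :=
  (qpow h z - qpow h (-z)) / (Complex.exp h - (Complex.exp h)⁻¹)

/-- `q = exp h` as a unit of `ℂ`. -/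
noncomputable def qUnit (h : ℂ) : ℂˣ := Units.mk0 (Complex.exp h) (Complex.exp_ne_zero h)

theorem qUnit_val (h : ℂ) : ((qUnit h : ℂˣ) : ℂ) = Complex.exp h := rfl

/-- The underlying space of `V_λ`, with coordinates indexed by `0, …, p - 1`. -/
abbrev V (p : ℕ) : Type := Fin p → ℂ

/-- The normal basis vector `v_i` of `V_λ` for `i < p`, and `0` for `i ≥ p`. -/
noncomputable def v (p i : ℕ) : V p := if hi : i < p then Pi.single ⟨i, hi⟩ 1 else 0

/-- `K v_i = q ^ (λ - 2 i) v_i`. -/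
noncomputable def opK (p : ℕ) (h lam : ℂ) : Module.End ℂ (V p) :=
  (Pi.basisFun ℂ (Fin p)).constr ℂ fun i => qpow h (lam - 2 * (i : ℕ)) • v p i

/-- `K⁻¹ v_i = q ^ (-(λ - 2 i)) v_i`. -/
noncomputable def opKinv (p : ℕ) (h lam : ℂ) : Module.End ℂ (V p) :=
  (Pi.basisFun ℂ (Fin p)).constr ℂ fun i => qpow h (-(lam - 2 * (i : ℕ))) • v p i

/-- `f v_i = [i + 1] v_{i + 1}` for `i ≠ p - 1`, and `f v_{p - 1} = 0`. -/
noncomputable def opf (p : ℕ) (h : ℂ) : Module.End ℂ (V p) :=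
  (Pi.basisFun ℂ (Fin p)).constr ℂ fun i => qnum h ((i : ℕ) + 1) • v p (i + 1)

/-- `e v_i = [λ + 1 - i] v_{i - 1}` for `i ≠ 0`, and `e v_0 = 0`. -/
noncomputable def ope (p : ℕ) (h lam : ℂ) : Module.End ℂ (V p) :=
  (Pi.basisFun ℂ (Fin p)).constr ℂ fun i =>
    if (i : ℕ) = 0 then 0 else qnum h (lam + 1 - (i : ℕ)) • v p (i - 1)

theorem basisFun_eq_v {p i : ℕ} (hi : i < p) : Pi.basisFun ℂ (Fin p) ⟨i, hi⟩ = v p i := by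
  simp [v, hi]

theorem opK_v (p : ℕ) (h lam : ℂ) (i : ℕ) :
    opK p h lam (v p i) = qpow h (lam - 2 * i) • v p i := by
  by_cases hi : i < p
  · rw [opK, ← basisFun_eq_v hi, Module.Basis.constr_basis, basisFun_eq_v hi]
  · simp [v, hi]

theorem opKinv_v (p : ℕ) (h lam : ℂ) (i : ℕ) :
    opKinv p h lam (v p i) = qpow h (-(lam - 2 * i)) • v p i := by
  by_cases hi : i < p
  · rw [opKinv, ← basisFun_eq_v hi, Module.Basis.constr_basis, basisFun_eq_v hi]
  · simp [v, hi]

theorem opf_v (p : ℕ) (h : ℂ) (i : ℕ) : opf p h (v p i) = qnum h (i + 1) • v p (i + 1) := by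
  by_cases hi : i < p
  · rw [opf, ← basisFun_eq_v hi, Module.Basis.constr_basis]
  · have : ¬ i + 1 < p := by omega
    simp [v, hi, this]

theorem ope_v_zero (p : ℕ) (h lam : ℂ) : ope p h lam (v p 0) = 0 := by
  by_cases hi : 0 < p
  · rw [ope, ← basisFun_eq_v hi, Module.Basis.constr_basis]; simp
  · simp [v, hi]

theorem ope_v_succ (p : ℕ) (h lam : ℂ) {i : ℕ} (hi : i + 1 < p) :
    ope p h lam (v p (i + 1)) = qnum h (lam - i) • v p i := by
  rw [ope, ← basisFun_eq_v hi, Module.Basis.constr_basis]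
  simp

theorem end_ext_v {p : ℕ} {S T : Module.End ℂ (V p)} (H : ∀ i < p, S (v p i) = T (v p i)) :
    S = T := by
  refine (Pi.basisFun ℂ (Fin p)).ext fun i => ?_
  have := H i i.2
  rwa [← basisFun_eq_v i.2] at this

theorem qpow_add (h a b : ℂ) : qpow h (a + b) = qpow h a * qpow h b := by
  simp [qpow, mul_add, Complex.exp_add]

theorem qpow_neg (h a : ℂ) : qpow h (-a) = (qpow h a)⁻¹ := by
  simp [qpow, Complex.exp_neg]

theorem qpow_ne_zero (h a : ℂ) : qpow h a ≠ 0 := Complex.exp_ne_zero _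

theorem qpow_nat (h : ℂ) (n : ℕ) : qpow h n = Complex.exp h ^ n := by
  rw [qpow, mul_comm, Complex.exp_nat_mul]

theorem qpow_one (h : ℂ) : qpow h 1 = Complex.exp h := by simp [qpow]

theorem qnum_zero (h : ℂ) : qnum h 0 = 0 := by simp [qnum]

theorem qnum_nat_eq_zero {p : ℕ} {h : ℂ} (hp : Complex.exp h ^ p = 1) : qnum h p = 0 := by
  rw [qnum, qpow_neg, qpow_nat, hp]; simp

theorem qnum_identity (h a b : ℂ) :
    qnum h (b + 1) * qnum h (a - b) - qnum h b * qnum h (a - b + 1) = qnum h (a - 2 * b) := by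
  have ha := qpow_ne_zero h a
  have hb := qpow_ne_zero h b
  have h1 : Complex.exp h ≠ 0 := Complex.exp_ne_zero h
  by_cases hd : Complex.exp h - (Complex.exp h)⁻¹ = 0
  · simp [qnum, hd]
  have e1 : a - 2 * b = a + (-b + -b) := by ring
  simp only [qnum, e1, sub_eq_add_neg a b, qpow_neg, qpow_add, qpow_one]
  generalize hD : Complex.exp h - (Complex.exp h)⁻¹ = D at hd ⊢
  generalize Complex.exp h = q at *
  generalize qpow h a = A at *
  generalize qpow h b = B at *
  field_simp
  rw [← hD]
  field_simp
  ring

/-- The operators on `V_λ` satisfy the relations of `U_q(sl₂)`. -/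
theorem isSl2_op {p : ℕ} {h : ℂ} (hp : Complex.exp h ^ p = 1) (lam : ℂ) :
    IsSl2 (qUnit h) (ope p h lam) (opf p h) (opK p h lam) (opKinv p h lam) where
  K_K' := end_ext_v fun i _ => by
    rw [Module.End.mul_apply, opKinv_v, map_smul, opK_v, smul_smul, qpow_neg,
      inv_mul_cancel₀ (qpow_ne_zero _ _), one_smul, Module.End.one_apply]
  K'_K := end_ext_v fun i _ => by
    rw [Module.End.mul_apply, opK_v, map_smul, opKinv_v, smul_smul, qpow_neg,
      mul_inv_cancel₀ (qpow_ne_zero _ _), one_smul, Module.End.one_apply]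
  K_e := end_ext_v fun i hi => by
    rcases i with _ | i
    · simp [opKinv_v, ope_v_zero]
    · simp only [Module.End.mul_apply, opKinv_v, map_smul, ope_v_succ p h lam hi, opK_v,
        LinearMap.smul_apply, smul_smul, qUnit, Units.val_mk0]
      congr 1
      have e : lam - 2 * (i : ℂ) = (lam - 2 * ((i + 1 : ℕ) : ℂ)) + (1 + 1) := by push_cast; ring
      have := qpow_ne_zero h (lam - 2 * ((i + 1 : ℕ) : ℂ))
      rw [e, qpow_add, qpow_add h 1 1, qpow_one, qpow_neg]
      field_simp
  K_f := end_ext_v fun i _ => by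
    simp only [Module.End.mul_apply, opKinv_v, map_smul, opf_v, opK_v,
        LinearMap.smul_apply, smul_smul, qUnit, Units.val_mk0]
    congr 1
    have e : lam - 2 * (i : ℂ) = (lam - 2 * ((i + 1 : ℕ) : ℂ)) + (1 + 1) := by push_cast; ring
    have := qpow_ne_zero h (lam - 2 * ((i + 1 : ℕ) : ℂ))
    have := Complex.exp_ne_zero h
    rw [e, qpow_neg, qpow_add, qpow_add h 1 1, qpow_one]
    field_simp
  e_f := end_ext_v fun i hi => by
    have key : (ope p h lam * opf p h) (v p i) = (qnum h (i + 1) * qnum h (lam - i)) • v p i := by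
      rw [Module.End.mul_apply, opf_v, map_smul]
      by_cases hi' : i + 1 < p
      · rw [ope_v_succ p h lam hi', smul_smul]
      · have h0 : qnum h ((i : ℂ) + 1) = 0 := by
          rw [← Nat.cast_succ, show Nat.succ i = p by omega, qnum_nat_eq_zero hp]
        simp [h0]
    have key' : (opf p h * ope p h lam) (v p i) =
        (qnum h i * qnum h (lam - i + 1)) • v p i := by
      rw [Module.End.mul_apply]
      rcases i with _ | i
      · simp [ope_v_zero, qnum_zero]
      · rw [ope_v_succ p h lam hi, map_smul, opf_v, smul_smul]
        congr 1
        push_cast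
        rw [show lam - ((i : ℂ) + 1) + 1 = lam - i by ring, mul_comm]
    rw [LinearMap.sub_apply, key, key', ← sub_smul, qnum_identity, LinearMap.smul_apply,
      LinearMap.sub_apply, opK_v, opKinv_v, ← sub_smul, smul_smul]
    congr 1
    simp only [qnum, qUnit, Units.val_mk0]
    rw [div_eq_inv_mul]

/-- The `p`-dimensional `U_q(sl₂)`-module `V_λ`, as a representation (`q = exp h`, `q ^ p = 1`). -/
noncomputable def rep {p : ℕ} {h : ℂ} (hp : Complex.exp h ^ p = 1) (lam : ℂ) :
    Uqsl2 (qUnit h) →ₐ[ℂ] Module.End ℂ (V p) :=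
  Uqsl2.lift (isSl2_op hp lam)

/-- The `U_q(ŝl₂)`-module `V_{λ₁}(x) ⊗ V_{λ₂}(y)`: an element `g` acts as
`(ev_x ⊗ ev_y)(Δ g)` acts on `V_{λ₁} ⊗ V_{λ₂}`. -/
noncomputable def tensorRep {p : ℕ} {h : ℂ} (hp : Complex.exp h ^ p = 1) (lam₁ lam₂ : ℂ)
    (x y : ℂˣ) : UqAff (qUnit h) →ₐ[ℂ] Module.End ℂ (V p ⊗[ℂ] V p) :=
  ((Module.endTensorEndAlgHom (R := ℂ) (S := ℂ) (A := ℂ) (M := V p) (N := V p)).comp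
    (Algebra.TensorProduct.map (rep hp lam₁) (rep hp lam₂))).comp
    ((Algebra.TensorProduct.map (ev (qUnit h) x) (ev (qUnit h) y)).comp (comul (qUnit h)))

/-- The highest weight vector `Ω₀ = ([λ₂]_q / [λ₁ + 1]_q) v₀ ⊗ w₀`. -/
noncomputable def Omega0 (p : ℕ) (h lam₁ lam₂ : ℂ) : V p ⊗[ℂ] V p :=
  (qnum h lam₂ / qnum h (lam₁ + 1)) • (v p 0 ⊗ₜ[ℂ] v p 0)

/-- The genericity condition on the weights: `[λ_j + 1 - i] ≠ 0` for `0 ≤ i ≤ p`, `j = 1, 2`, and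
`[λ₁ + λ₂ - 2 j + 1 - i] ≠ 0` for `0 ≤ i ≤ p`, `0 ≤ j ≤ p - 1`. -/
def GenericWeights (p : ℕ) (h lam₁ lam₂ : ℂ) : Prop :=
  (∀ i : ℕ, i ≤ p → qnum h (lam₁ + 1 - i) ≠ 0) ∧
  (∀ i : ℕ, i ≤ p → qnum h (lam₂ + 1 - i) ≠ 0) ∧
  (∀ i j : ℕ, i ≤ p → j < p → qnum h (lam₁ + lam₂ - 2 * j + 1 - i) ≠ 0)

/-- The condition `y / x ≠ q ^ (-(λ₁ + λ₂ - 2 (l - 1)))` for `l = 1, …, p - 1`. -/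
def NonresonantRatio (p : ℕ) (h lam₁ lam₂ : ℂ) (x y : ℂˣ) : Prop :=
  ∀ l : ℕ, 1 ≤ l → l ≤ p - 1 →
    (y : ℂ) / (x : ℂ) ≠ qpow h (-(lam₁ + lam₂ - 2 * ((l : ℂ) - 1)))

/-- How `e₀` acts on the tensor product. -/
theorem tensorRep_e0 {p : ℕ} {h : ℂ} (hp : Complex.exp h ^ p = 1) (lam₁ lam₂ : ℂ) (x y : ℂˣ) :
    tensorRep hp lam₁ lam₂ x y (UqAff.gen (qUnit h) (.e 0)) =
      ((Complex.exp h)⁻¹ * x) • TensorProduct.map (opf p h) (opKinv p h lam₂) +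
      ((Complex.exp h)⁻¹ * y) • TensorProduct.map LinearMap.id (opf p h) := by
  simp [tensorRep, comul, ev, rep, UqAff.lift_gen, affAssign, Uqsl2.lift_gen, sl2Assign,
    Module.endTensorEndAlgHom_apply, qUnit_val, TensorProduct.smul_tmul',
    TensorProduct.AlgebraTensorModule.map_eq, TensorProduct.map_smul_left,
    Module.End.one_eq_id]

/-- How `f = f₁` acts on the tensor product. -/
theorem tensorRep_f1 {p : ℕ} {h : ℂ} (hp : Complex.exp h ^ p = 1) (lam₁ lam₂ : ℂ) (x y : ℂˣ) :
    tensorRep hp lam₁ lam₂ x y (UqAff.gen (qUnit h) (.f 1)) =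
      TensorProduct.map (opf p h) LinearMap.id +
      TensorProduct.map (opKinv p h lam₁) (opf p h) := by
  simp [tensorRep, comul, ev, rep, UqAff.lift_gen, affAssign, Uqsl2.lift_gen, sl2Assign,
    Module.endTensorEndAlgHom_apply, TensorProduct.AlgebraTensorModule.map_eq,
    Module.End.one_eq_id]

end QuantumAffine

/-!
Write `E` and `F` for the actions of `e₀` and `f₁`. They commute, both raise by one the degree
`i + j` of the basis vectors `v_i ⊗ w_j`, and `E ^ n`, `F ^ n` send `v₀ ⊗ w₀` to `[n]!` times an
explicit vector (`pow_apply_tmul_zero`), so `E ^ p` and `F ^ p` kill `Ω₀` because `[p] = 0`.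
Hence `Ω₀` generates a quotient of `ℂ[E, F] / (E ^ p, F ^ p)`. The socle of this algebra is spanned
by `E ^ (p - 1) F ^ (p - 1)`, so the `p²` vectors `E ^ i F ^ j Ω₀` are independent if and only if
`E ^ (p - 1) F ^ (p - 1) Ω₀ ≠ 0` (`linearIndependent_pow_pow_apply`); there being `p²` of them,
they then form a basis.

The vector `E ^ (p - 1) F ^ (p - 1) Ω₀` lies in the line of `v_{p-1} ⊗ w_{p-1}`. Expanding
`F ^ (p - 1) Ω₀` and applying `E ^ (p - 1)` to each of its terms (`e0_pow_apply_tmul`), the powers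
of `q` with exponents quadratic in `i, j` cancel, and up to a nonzero factor the coefficient is the
geometric sum `∑ z ^ i y ^ j` over `i + j = p - 1`, where `z = x q ^ (-λ₁ - λ₂ - 2)`. It vanishes exactly when
`y / z` is a nontrivial `p`-th root of unity, that is `y = z q ^ (2 l)` with `1 ≤ l ≤ p - 1`, since
`q²` is a primitive `p`-th root of unity for odd `p`.
-/

namespace QuantumAffine

open scoped TensorProduct
open Finset

/-! ### Commuting nilpotent operators and a cyclic vector -/

/-- In `K[E, F] / (E ^ p, F ^ p)` every nonzero ideal contains the socle element
`E ^ (p - 1) F ^ (p - 1)`; a cyclic vector that it does not kill is therefore free. -/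
theorem linearIndependent_pow_pow_apply {K M : Type*} [Field K] [AddCommGroup M] [Module K M]
    {E F : Module.End K M} (hEF : Commute E F) {p : ℕ} {w : M}
    (hE : (E ^ p) w = 0) (hF : (F ^ p) w = 0) (hw : (E ^ (p - 1) * F ^ (p - 1)) w ≠ 0) :
    LinearIndependent K fun a : Fin p × Fin p => (E ^ (a.1 : ℕ) * F ^ (a.2 : ℕ)) w := by
  have hE' : ∀ i j, p ≤ i → (E ^ i * F ^ j) w = 0 := fun i j hi => by
    rw [(hEF.pow_pow i j).eq, ← Nat.sub_add_cancel hi, pow_add, ← mul_assoc, Module.End.mul_apply,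
      hE, map_zero]
  have hF' : ∀ i j, p ≤ j → (E ^ i * F ^ j) w = 0 := fun i j hj => by
    rw [← Nat.sub_add_cancel hj, pow_add, ← mul_assoc, Module.End.mul_apply, hF, map_zero]
  classical
  rw [Fintype.linearIndependent_iff]
  intro c hc
  by_contra! hne
  -- A nonzero coefficient of least total degree is isolated by the complementary monomial.
  obtain ⟨a, ha, hmin⟩ := Finset.exists_min_image (univ.filter fun a => c a ≠ 0)
    (fun a : Fin p × Fin p => (a.1 : ℕ) + a.2) (by
      obtain ⟨a, ha⟩ := hne
      exact ⟨a, by simpa using ha⟩)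
  simp only [mem_filter, mem_univ, true_and] at ha hmin
  have h0 := congrArg (E ^ (p - 1 - (a.1 : ℕ)) * F ^ (p - 1 - (a.2 : ℕ))) hc
  have hcomb : ∀ b : Fin p × Fin p,
      (E ^ (p - 1 - (a.1 : ℕ)) * F ^ (p - 1 - (a.2 : ℕ))) ((E ^ (b.1 : ℕ) * F ^ (b.2 : ℕ)) w) =
        (E ^ (p - 1 - (a.1 : ℕ) + b.1) * F ^ (p - 1 - (a.2 : ℕ) + b.2)) w := fun b => by
    rw [← Module.End.mul_apply, mul_assoc, ← mul_assoc (F ^ _) (E ^ _),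
      ← (hEF.pow_pow _ _).eq, pow_add, pow_add]
    simp only [mul_assoc]
  have ha1 := a.1.2
  have ha2 := a.2.2
  rw [map_sum, map_zero, Finset.sum_eq_single a] at h0
  · rw [map_smul, hcomb, Nat.sub_add_cancel (by omega), Nat.sub_add_cancel (by omega)] at h0
    exact (smul_ne_zero ha hw) h0
  · intro b _ hba
    by_cases hb : c b = 0
    · simp [hb]
    rw [map_smul, hcomb]
    have hdeg := hmin b hb
    have hb' : p ≤ p - 1 - (a.1 : ℕ) + b.1 ∨ p ≤ p - 1 - (a.2 : ℕ) + b.2 := by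
      by_contra! hlt
      exact hba (Prod.ext (Fin.ext (by omega)) (Fin.ext (by omega)))
    rcases hb' with hb' | hb'
    · rw [hE' _ _ hb', smul_zero]
    · rw [hF' _ _ hb', smul_zero]
  · simp

/-! ### `q`-numbers -/

theorem qnum_add (h a b : ℂ) :
    qnum h a * qpow h (-b) + qnum h b * qpow h a = qnum h (a + b) := by
  simp only [qnum, neg_add, qpow_add, div_mul_eq_mul_div, ← add_div]
  ring

/-- The `q`-factorial `[n]! = [1] [2] ⋯ [n]`. -/
noncomputable def qfact (h : ℂ) (n : ℕ) : ℂ := ∏ k ∈ range n, qnum h (k + 1)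

theorem qfact_succ (h : ℂ) (n : ℕ) : qfact h (n + 1) = qfact h n * qnum h (n + 1) :=
  prod_range_succ _ _

theorem qnum_nat_ne_zero {p : ℕ} (hpodd : Odd p) {h : ℂ} (hq : IsPrimitiveRoot (Complex.exp h) p)
    {k : ℕ} (hk : 0 < k) (hkp : k < p) : qnum h k ≠ 0 := by
  have hne := Complex.exp_ne_zero h
  have hq2 : IsPrimitiveRoot (Complex.exp h ^ 2) p :=
    hq.pow_of_coprime 2 (Nat.coprime_two_left.mpr hpodd)
  have key : ∀ m : ℕ, 0 < m → m < p → Complex.exp h ^ m - (Complex.exp h ^ m)⁻¹ ≠ 0 := by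
    intro m hm hmp h0
    refine hq2.pow_ne_one_of_pos_of_lt hm.ne' hmp ?_
    rw [sub_eq_zero] at h0
    rw [← pow_mul, mul_comm 2, pow_mul, pow_two]
    nth_rewrite 1 [h0]
    exact inv_mul_cancel₀ (pow_ne_zero _ hne)
  rw [qnum, qpow_neg, qpow_nat]
  refine div_ne_zero (key k hk hkp) ?_
  simpa using key 1 one_pos (by omega)

theorem qfact_ne_zero {p : ℕ} (hpodd : Odd p) {h : ℂ} (hq : IsPrimitiveRoot (Complex.exp h) p)
    {n : ℕ} (hn : n < p) : qfact h n ≠ 0 :=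
  prod_ne_zero_iff.mpr fun k hk => by
    have := mem_range.mp hk
    exact_mod_cast qnum_nat_ne_zero hpodd hq (Nat.succ_pos k) (by omega)

theorem qfact_eq_zero {p : ℕ} (hp : 0 < p) {h : ℂ} (hq : Complex.exp h ^ p = 1) :
    qfact h p = 0 := by
  obtain ⟨n, rfl⟩ : ∃ n, p = n + 1 := ⟨p - 1, by omega⟩
  have := qnum_nat_eq_zero hq
  rw [qfact_succ, ← Nat.cast_succ, this, mul_zero]

theorem qnum_of_add_eq {p : ℕ} {h : ℂ} (hq : Complex.exp h ^ p = 1) {i r : ℕ} (hir : i + r = p) :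
    qnum h i = -qnum h r := by
  have h1 : Complex.exp h ^ i * Complex.exp h ^ r = 1 := by rw [← pow_add, hir, hq]
  rw [qnum, qnum, qpow_neg, qpow_neg, qpow_nat, qpow_nat, eq_inv_of_mul_eq_one_left h1, inv_inv]
  ring

/-! ### Powers of the operators `e₀` and `f₁` -/

/-- If `T` sends `v_i ⊗ w_j` into the span of `v_{i+1} ⊗ w_j` and `v_i ⊗ w_{j+1}`, with coefficients
`[i + 1] A i j` and `[j + 1] B i j`, and `c` solves the corresponding recursion of
Pascal type, then `T ^ n` sends `v₀ ⊗ w₀` to `[n]! ∑ c i j v_i ⊗ w_j`. -/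
theorem pow_apply_tmul_zero {p : ℕ} {h : ℂ} {T : Module.End ℂ (V p ⊗[ℂ] V p)} {A B c : ℕ → ℕ → ℂ}
    {α β : ℕ → ℂ}
    (hT : ∀ i j, T (v p i ⊗ₜ v p j) = (qnum h (i + 1) * A i j) • (v p (i + 1) ⊗ₜ[ℂ] v p j) +
      (qnum h (j + 1) * B i j) • (v p i ⊗ₜ[ℂ] v p (j + 1)))
    (h0 : c 0 0 = 1)
    (hA : ∀ i j, c i j * A i j = c (i + 1) j * α j)
    (hB : ∀ i j, c i j * B i j = c i (j + 1) * β i)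
    (hαβ : ∀ i j : ℕ, qnum h i * α j + qnum h j * β i = qnum h (i + j)) (n : ℕ) :
    (T ^ n) (v p 0 ⊗ₜ v p 0) =
      qfact h n • ∑ a ∈ antidiagonal n, c a.1 a.2 • (v p a.1 ⊗ₜ[ℂ] v p a.2) := by
  induction n with
  | zero => simp [qfact, h0]
  | succ n ih =>
    -- Both shifted sums extend to the next antidiagonal, the boundary terms being multiples of `[0]`.
    have s1 : ∑ a ∈ antidiagonal n,
        (c (a.1 + 1) a.2 * α a.2 * qnum h (a.1 + 1)) • (v p (a.1 + 1) ⊗ₜ[ℂ] v p a.2) =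
        ∑ a ∈ antidiagonal (n + 1),
          (c a.1 a.2 * α a.2 * qnum h a.1) • (v p a.1 ⊗ₜ[ℂ] v p a.2) := by
      rw [Finset.Nat.sum_antidiagonal_succ]
      simp [qnum_zero]
    have s2 : ∑ a ∈ antidiagonal n,
        (c a.1 (a.2 + 1) * β a.1 * qnum h (a.2 + 1)) • (v p a.1 ⊗ₜ[ℂ] v p (a.2 + 1)) =
        ∑ a ∈ antidiagonal (n + 1),
          (c a.1 a.2 * β a.1 * qnum h a.2) • (v p a.1 ⊗ₜ[ℂ] v p a.2) := by
      rw [Finset.Nat.sum_antidiagonal_succ']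
      simp [qnum_zero]
    rw [pow_succ', Module.End.mul_apply, ih, map_smul, map_sum, qfact_succ, mul_smul]
    congr 1
    calc ∑ a ∈ antidiagonal n, T (c a.1 a.2 • (v p a.1 ⊗ₜ[ℂ] v p a.2))
        = ∑ a ∈ antidiagonal n,
            (c (a.1 + 1) a.2 * α a.2 * qnum h (a.1 + 1)) • (v p (a.1 + 1) ⊗ₜ[ℂ] v p a.2) +
          ∑ a ∈ antidiagonal n,
            (c a.1 (a.2 + 1) * β a.1 * qnum h (a.2 + 1)) •
              (v p a.1 ⊗ₜ[ℂ] v p (a.2 + 1)) := by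
          rw [← sum_add_distrib]
          refine sum_congr rfl fun a _ => ?_
          rw [map_smul, hT, smul_add, smul_smul, smul_smul, ← hA, ← hB]
          congr 2 <;> ring
      _ = _ := by
          rw [s1, s2, ← sum_add_distrib, smul_sum]
          refine sum_congr rfl fun a ha => ?_
          rw [← add_smul, smul_smul]
          congr 1
          have hn : ((n : ℂ) + 1) = a.1 + a.2 := by
            have := mem_antidiagonal.mp ha
            exact_mod_cast this.symm
          rw [hn, ← hαβ]
          ring

theorem map_opf_opKinv_apply {p : ℕ} (h lam : ℂ) (i j : ℕ) :
    TensorProduct.map (opf p h) (opKinv p h lam) (v p i ⊗ₜ[ℂ] v p j) =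
      (qnum h (i + 1) * qpow h (-(lam - 2 * j))) • (v p (i + 1) ⊗ₜ[ℂ] v p j) := by
  rw [TensorProduct.map_tmul, opf_v, opKinv_v, TensorProduct.smul_tmul_smul]

section Action

variable {p : ℕ} {h : ℂ} (hp : Complex.exp h ^ p = 1) (lam₁ lam₂ : ℂ) (x y : ℂˣ)

theorem tensorRep_e0_apply (i j : ℕ) :
    tensorRep hp lam₁ lam₂ x y (UqAff.gen (qUnit h) (.e 0)) (v p i ⊗ₜ v p j) =
      (qnum h (i + 1) * ((Complex.exp h)⁻¹ * x * qpow h (-(lam₂ - 2 * j)))) •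
        (v p (i + 1) ⊗ₜ[ℂ] v p j) +
      (qnum h (j + 1) * ((Complex.exp h)⁻¹ * y)) • (v p i ⊗ₜ[ℂ] v p (j + 1)) := by
  rw [tensorRep_e0, LinearMap.add_apply, LinearMap.smul_apply, LinearMap.smul_apply,
    map_opf_opKinv_apply, TensorProduct.map_tmul, opf_v, LinearMap.id_apply,
    TensorProduct.tmul_smul, smul_smul, smul_smul]
  congr 2 <;> ring

theorem tensorRep_f1_apply (i j : ℕ) :
    tensorRep hp lam₁ lam₂ x y (UqAff.gen (qUnit h) (.f 1)) (v p i ⊗ₜ v p j) =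
      (qnum h (i + 1) * 1) • (v p (i + 1) ⊗ₜ[ℂ] v p j) +
      (qnum h (j + 1) * qpow h (-(lam₁ - 2 * i))) • (v p i ⊗ₜ[ℂ] v p (j + 1)) := by
  rw [tensorRep_f1, LinearMap.add_apply, TensorProduct.map_tmul, TensorProduct.map_tmul, opf_v,
    opf_v, opKinv_v, LinearMap.id_apply, TensorProduct.smul_tmul_smul, ← TensorProduct.smul_tmul',
    mul_one, mul_comm (qpow _ _)]

theorem commute_tensorRep_e0_f1 :
    Commute (tensorRep hp lam₁ lam₂ x y (UqAff.gen (qUnit h) (.e 0)))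
      (tensorRep hp lam₁ lam₂ x y (UqAff.gen (qUnit h) (.f 1))) :=
  Commute.map (sub_eq_zero.mp ((UqAff.isAff (qUnit h)).e_f_ne 0 1 (by decide))) _

theorem f1_pow_apply (n : ℕ) :
    (tensorRep hp lam₁ lam₂ x y (UqAff.gen (qUnit h) (.f 1)) ^ n) (v p 0 ⊗ₜ v p 0) =
      qfact h n • ∑ a ∈ antidiagonal n,
        qpow h (-lam₁ * a.2 + a.1 * a.2) • (v p a.1 ⊗ₜ[ℂ] v p a.2) := by
  refine pow_apply_tmul_zero (tensorRep_f1_apply hp lam₁ lam₂ x y)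
    (c := fun i j => qpow h (-lam₁ * j + i * j)) (α := fun j => qpow h (-j))
    (β := fun i => qpow h i) ?_ ?_ ?_ (fun i j => qnum_add h i j) n
  · simp [qpow]
  · intro i j
    rw [mul_one, ← qpow_add]
    congr 1
    push_cast
    ring
  · intro i j
    rw [← qpow_add, ← qpow_add]
    congr 1
    push_cast
    ring

theorem e0_pow_apply (n : ℕ) :
    (tensorRep hp lam₁ lam₂ x y (UqAff.gen (qUnit h) (.e 0)) ^ n) (v p 0 ⊗ₜ v p 0) =
      qfact h n • ∑ a ∈ antidiagonal n,
        (((Complex.exp h)⁻¹ * x) ^ a.1 * ((Complex.exp h)⁻¹ * y) ^ a.2 *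
          qpow h (-lam₂ * a.1 + a.1 * a.2)) • (v p a.1 ⊗ₜ[ℂ] v p a.2) := by
  refine pow_apply_tmul_zero (tensorRep_e0_apply hp lam₁ lam₂ x y)
    (c := fun i j => ((Complex.exp h)⁻¹ * x) ^ i * ((Complex.exp h)⁻¹ * y) ^ j *
      qpow h (-lam₂ * i + i * j)) (α := fun j => qpow h j)
    (β := fun i => qpow h (-i)) ?_ ?_ ?_ ?_ n
  · simp [qpow]
  · intro i j
    have e : qpow h (-lam₂ * i + i * j) * qpow h (-(lam₂ - 2 * j)) =
        qpow h (-lam₂ * (i + 1 : ℕ) + (i + 1 : ℕ) * j) * qpow h j := by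
      rw [← qpow_add, ← qpow_add]
      congr 1
      push_cast
      ring
    linear_combination (((Complex.exp h)⁻¹ * x) ^ (i + 1) * ((Complex.exp h)⁻¹ * y) ^ j) * e
  · intro i j
    have e : qpow h (-lam₂ * i + i * j) =
        qpow h (-lam₂ * i + i * (j + 1 : ℕ)) * qpow h (-i) := by
      rw [← qpow_add]
      congr 1
      push_cast
      ring
    linear_combination (((Complex.exp h)⁻¹ * x) ^ i * ((Complex.exp h)⁻¹ * y) ^ (j + 1)) * e
  · intro i j
    rw [add_comm (i : ℂ), ← qnum_add h j i, add_comm]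

/-- In degree `2 (p - 1) - n` the power `e₀ ^ n` reaches the line of `v_{p-1} ⊗ w_{p-1}`. Counted
from the top, `r = p - 1 - i` and `s = p - 1 - j`, the coefficients `[i + 1]` and `[j + 1]` of `e₀`
become `-[r]` and `-[s]`. -/
theorem e0_pow_apply_tmul (n : ℕ) {i j r s : ℕ} (hi : i + 1 + r = p) (hj : j + 1 + s = p)
    (hrs : r + s = n) :
    (tensorRep hp lam₁ lam₂ x y (UqAff.gen (qUnit h) (.e 0)) ^ n) (v p i ⊗ₜ v p j) =
      ((-1) ^ n * qfact h n * (((Complex.exp h)⁻¹ * x) ^ r * ((Complex.exp h)⁻¹ * y) ^ s *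
        qpow h (-lam₂ * r - 2 * r - r * s))) • (v p (p - 1) ⊗ₜ[ℂ] v p (p - 1)) := by
  induction n generalizing i j r s with
  | zero =>
    obtain ⟨rfl, rfl⟩ : r = 0 ∧ s = 0 := by omega
    obtain rfl : i = p - 1 := by omega
    obtain rfl : j = p - 1 := by omega
    simp [qfact, qpow]
  | succ n ih =>
    have hi' : qnum h (i + 1) = -qnum h r := by exact_mod_cast qnum_of_add_eq hp hi
    have hj' : qnum h (j + 1) = -qnum h s := by exact_mod_cast qnum_of_add_eq hp hj
    have hn : (n : ℂ) + 1 = r + s := by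
      exact_mod_cast hrs.symm
    have hjp : (j : ℂ) + 1 + s = p := by exact_mod_cast hj
    have hpq : qpow h (2 * p) = 1 := by
      rw [two_mul, qpow_add, qpow_nat, hp, one_mul]
    rw [pow_succ, Module.End.mul_apply, tensorRep_e0_apply, map_add, map_smul, map_smul, hi', hj',
      qfact_succ, hn, ← qnum_add h r s]
    generalize (Complex.exp h)⁻¹ * (x : ℂ) = X at ih ⊢
    generalize (Complex.exp h)⁻¹ * (y : ℂ) = Y at ih ⊢
    have t1 : (-qnum h r * (X * qpow h (-(lam₂ - 2 * j)))) •
        (tensorRep hp lam₁ lam₂ x y (UqAff.gen (qUnit h) (.e 0)) ^ n) (v p (i + 1) ⊗ₜ v p j) =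
        ((-1) ^ (n + 1) * qfact h n * (X ^ r * Y ^ s * qpow h (-lam₂ * r - 2 * r - r * s)) *
          (qnum h r * qpow h (-s))) • (v p (p - 1) ⊗ₜ[ℂ] v p (p - 1)) := by
      rcases r with _ | r
      · simp [qnum_zero]
      rw [ih (r := r) (s := s) (by omega) hj (by omega), smul_smul]
      congr 1
      have e : qpow h (-(lam₂ - 2 * j)) * qpow h (-lam₂ * r - 2 * r - r * s) =
          qpow h (-lam₂ * (r + 1 : ℕ) - 2 * (r + 1 : ℕ) - (r + 1 : ℕ) * s) * qpow h (-s) := by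
        rw [← mul_one (_ * qpow h (-s)), ← hpq, ← qpow_add, ← qpow_add, ← qpow_add]
        congr 1
        push_cast
        linear_combination 2 * hjp
      linear_combination
        ((-1) ^ (n + 1) * qfact h n * qnum h (r + 1 : ℕ) * X ^ (r + 1) * Y ^ s) * e
    have t2 : (-qnum h s * Y) •
        (tensorRep hp lam₁ lam₂ x y (UqAff.gen (qUnit h) (.e 0)) ^ n) (v p i ⊗ₜ v p (j + 1)) =
        ((-1) ^ (n + 1) * qfact h n * (X ^ r * Y ^ s * qpow h (-lam₂ * r - 2 * r - r * s)) *
          (qnum h s * qpow h r)) • (v p (p - 1) ⊗ₜ[ℂ] v p (p - 1)) := by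
      rcases s with _ | s
      · simp [qnum_zero]
      rw [ih (r := r) (s := s) hi (by omega) (by omega), smul_smul]
      congr 1
      have e : qpow h (-lam₂ * r - 2 * r - r * s) =
          qpow h (-lam₂ * r - 2 * r - r * (s + 1 : ℕ)) * qpow h r := by
        rw [← qpow_add]
        congr 1
        push_cast
        ring
      linear_combination ((-1) ^ (n + 1) * qfact h n * qnum h (s + 1 : ℕ) * X ^ r * Y ^ (s + 1)) * e
    rw [t1, t2, ← add_smul]
    congr 1
    ring

/-- The coefficient of the socle vector `e₀ ^ (p - 1) f₁ ^ (p - 1) (v₀ ⊗ w₀)` is a geometric sum: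
the powers `q ^ (i j)` from `f1_pow_apply` and `q ^ (-r s)` from `e0_pow_apply_tmul` cancel. -/
theorem e0_pow_mul_f1_pow_apply :
    (tensorRep hp lam₁ lam₂ x y (UqAff.gen (qUnit h) (.e 0)) ^ (p - 1) *
      tensorRep hp lam₁ lam₂ x y (UqAff.gen (qUnit h) (.f 1)) ^ (p - 1)) (v p 0 ⊗ₜ v p 0) =
      ((-1) ^ (p - 1) * qfact h (p - 1) ^ 2 * ∑ i ∈ range p, ((Complex.exp h)⁻¹ * y) ^ i *
        ((Complex.exp h)⁻¹ * x * qpow h (-(lam₁ + lam₂ + 2))) ^ (p - 1 - i)) •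
        (v p (p - 1) ⊗ₜ[ℂ] v p (p - 1)) := by
  rcases Nat.eq_zero_or_pos p with rfl | hp0
  · exact Subsingleton.elim _ _
  rw [Module.End.mul_apply, f1_pow_apply, map_smul, map_sum,
    Finset.Nat.sum_antidiagonal_eq_sum_range_succ_mk, Nat.succ_eq_add_one,
    Nat.sub_add_cancel hp0, mul_sum, sum_smul, smul_sum]
  refine sum_congr rfl fun i hi => ?_
  have hi' := mem_range.mp hi
  rw [map_smul, e0_pow_apply_tmul hp lam₁ lam₂ x y (p - 1) (i := i) (r := p - 1 - i) (s := i)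
    (by omega) (by omega) (by omega), smul_smul, smul_smul]
  congr 1
  have e : qpow h (-lam₁ * (p - 1 - i : ℕ) + i * (p - 1 - i : ℕ)) *
      qpow h (-lam₂ * (p - 1 - i : ℕ) - 2 * (p - 1 - i : ℕ) - (p - 1 - i : ℕ) * i) =
      qpow h (-(lam₁ + lam₂ + 2)) ^ (p - 1 - i) := by
    rw [← qpow_add, qpow, qpow, ← Complex.exp_nat_mul]
    congr 1
    ring
  rw [mul_pow _ (qpow h _), ← e]
  ring

end Action

/-! ### The resonance condition -/

/-- For `u ≠ 0` the sum is `(t ^ p - u ^ p) / (t - u)`, or `p u ^ (p - 1)` if `t = u`: its zeros are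
the products of `u` with the nontrivial `p`-th roots of unity. -/
theorem sum_pow_mul_pow_eq_zero_iff {K : Type*} [Field K] [CharZero K] {p : ℕ} (hp : 0 < p) {ζ : K}
    (hζ : IsPrimitiveRoot ζ p) {t u : K} (hu : u ≠ 0) :
    ∑ i ∈ range p, t ^ i * u ^ (p - 1 - i) = 0 ↔ ∃ l, 1 ≤ l ∧ l ≤ p - 1 ∧ t = u * ζ ^ l := by
  have hgeom := (Commute.all t u).geom_sum₂_mul p
  have : NeZero p := ⟨hp.ne'⟩
  constructor
  · intro h0
    rw [h0, zero_mul, eq_comm, sub_eq_zero] at hgeom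
    obtain ⟨l, hl, hlt⟩ := hζ.eq_pow_of_pow_eq_one (ξ := t / u) (by
      rw [div_pow, hgeom, div_self (pow_ne_zero _ hu)])
    have htu : t = u * ζ ^ l := by rw [hlt, mul_div_cancel₀ _ hu]
    refine ⟨l, Nat.one_le_iff_ne_zero.mpr ?_, by omega, htu⟩
    rintro rfl
    rw [pow_zero, mul_one] at htu
    subst htu
    rw [geom_sum₂_self] at h0
    exact mul_ne_zero (Nat.cast_ne_zero.mpr hp.ne') (pow_ne_zero _ hu) h0
  · rintro ⟨l, hl1, hl, rfl⟩
    rw [mul_pow u, ← pow_mul, mul_comm l, pow_mul, hζ.pow_eq_one, one_pow, mul_one, sub_self]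
      at hgeom
    refine (mul_eq_zero.mp hgeom).resolve_right fun h0 => ?_
    have h1 : ζ ^ l = 1 := by
      refine mul_left_cancel₀ hu ?_
      rw [mul_one]
      exact sub_eq_zero.mp h0
    exact hζ.pow_ne_one_of_pos_of_lt (by omega) (by omega) h1

theorem nonresonantRatio_iff {p : ℕ} (hp0 : 0 < p) (hpodd : Odd p) {h : ℂ}
    (hq : IsPrimitiveRoot (Complex.exp h) p) (lam₁ lam₂ : ℂ) (x y : ℂˣ) :
    NonresonantRatio p h lam₁ lam₂ x y ↔
      ∑ i ∈ range p, ((Complex.exp h)⁻¹ * y) ^ i *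
        ((Complex.exp h)⁻¹ * x * qpow h (-(lam₁ + lam₂ + 2))) ^ (p - 1 - i) ≠ 0 := by
  have hq2 : IsPrimitiveRoot (Complex.exp h ^ 2) p :=
    hq.pow_of_coprime 2 (Nat.coprime_two_left.mpr hpodd)
  have hne := inv_ne_zero (Complex.exp_ne_zero h)
  rw [Ne, sum_pow_mul_pow_eq_zero_iff hp0 hq2
    (mul_ne_zero (mul_ne_zero hne x.ne_zero) (qpow_ne_zero _ _))]
  push Not
  refine forall_congr' fun l => imp_congr_right fun _ => imp_congr_right fun _ => not_congr ?_
  have e : qpow h (-(lam₁ + lam₂ - 2 * ((l : ℂ) - 1))) =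
      qpow h (-(lam₁ + lam₂ + 2)) * (Complex.exp h ^ 2) ^ l := by
    rw [← pow_mul, ← qpow_nat, ← qpow_add]
    congr 1
    push_cast
    ring
  rw [e, div_eq_iff x.ne_zero, ← mul_right_inj' hne]
  constructor <;> intro H <;> rw [H] <;> ring

end QuantumAffine

open QuantumAffine in
/-- For `q = exp h` a primitive `p`-th root of unity, `p > 1` odd, and generic weights, the vectors
`e₀^i f^j Ω₀` (`0 ≤ i, j ≤ p - 1`) form a basis of `V_{λ₁}(x) ⊗ V_{λ₂}(y)` if and only if
`y / x ≠ q ^ (-(λ₁ + λ₂ - 2 (l - 1)))` for `l = 1, …, p - 1`. Here `f` acts as `f₁`. -/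
theorem theorem5p1 (p : ℕ) (hp1 : 1 < p) (hpodd : Odd p)
    (h : ℂ) (hq : IsPrimitiveRoot (Complex.exp h) p)
    (lam₁ lam₂ : ℂ) (x y : ℂˣ)
    (hgen : QuantumAffine.GenericWeights p h lam₁ lam₂) :
    (∃ b : Module.Basis (Fin p × Fin p) ℂ
        (TensorProduct ℂ (QuantumAffine.V p) (QuantumAffine.V p)),
      ∀ i j : Fin p, b (i, j) =
        QuantumAffine.tensorRep hq.pow_eq_one lam₁ lam₂ x y
          (QuantumAffine.UqAff.gen (QuantumAffine.qUnit h) (.e 0) ^ (i : ℕ) *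
            QuantumAffine.UqAff.gen (QuantumAffine.qUnit h) (.f 1) ^ (j : ℕ))
          (QuantumAffine.Omega0 p h lam₁ lam₂)) ↔
      QuantumAffine.NonresonantRatio p h lam₁ lam₂ x y := by
  have hp0 : 0 < p := by omega
  have hc : qnum h lam₂ / qnum h (lam₁ + 1) ≠ 0 :=
    div_ne_zero (by simpa using hgen.2.1 1 hp1.le) (by simpa using hgen.1 0 hp0.le)
  have htop : v p (p - 1) ⊗ₜ[ℂ] v p (p - 1) ≠ 0 := by
    have hlt : p - 1 < p := by omega
    rw [← basisFun_eq_v hlt, ← Module.Basis.tensorProduct_apply]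
    exact Module.Basis.ne_zero _ _
  have hsocle : (tensorRep hq.pow_eq_one lam₁ lam₂ x y (UqAff.gen (qUnit h) (.e 0)) ^ (p - 1) *
      tensorRep hq.pow_eq_one lam₁ lam₂ x y (UqAff.gen (qUnit h) (.f 1)) ^ (p - 1))
        (Omega0 p h lam₁ lam₂) ≠ 0 ↔ NonresonantRatio p h lam₁ lam₂ x y := by
    have hfact := qfact_ne_zero hpodd hq (Nat.sub_lt hp0 one_pos)
    rw [nonresonantRatio_iff hp0 hpodd hq, Omega0, map_smul, e0_pow_mul_f1_pow_apply]
    simp [hc, htop, hfact]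
  simp only [map_mul, map_pow]
  rw [← hsocle]
  constructor
  · rintro ⟨b, hb⟩
    have hlt : p - 1 < p := by omega
    rw [← hb ⟨p - 1, hlt⟩ ⟨p - 1, hlt⟩]
    exact b.ne_zero _
  · intro hw
    have hli := linearIndependent_pow_pow_apply
      (commute_tensorRep_e0_f1 hq.pow_eq_one lam₁ lam₂ x y)
      (by rw [Omega0, map_smul, e0_pow_apply, qfact_eq_zero hp0 hq.pow_eq_one, zero_smul, smul_zero])
      (by rw [Omega0, map_smul, f1_pow_apply, qfact_eq_zero hp0 hq.pow_eq_one, zero_smul, smul_zero])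
      hw
    have : Nonempty (Fin p) := ⟨⟨0, hp0⟩⟩
    exact ⟨basisOfLinearIndependentOfCardEqFinrank hli (by simp), fun i j => by simp⟩
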